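/- Let $G$ be a finite simple graph with vertex set $\{x_1,\ldots,x_n\}$, let $K$ be a field, let $R=K[x_1,\ldots,x_n]$, and let $I=I(G)\subset R$ be the edge ideal of $G$, that is, the ideal generated by all monomials $x_ix_j$ such that $\{x_i,x_j\}$ is an edge of $G$. Let $\mathfrak{m}=(x_1,\ldots,x_n)$ and let $k\geq 1$ be an integer. If $\mathfrak{m}\in\operatorname{Ass}(R/I^k)$, then $\mathfrak{m}\in\operatorname{Ass}(R/I^{k+1})$. Here $\operatorname{Ass}(R/J)$ denotes the set of prime ideals of $R$ of the form $(J:c)$ with $c\in R$. -/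

import Mathlib

/-- The edge ideal `I(G)` of a simple graph `G` on the vertex set `V`: the ideal of the polynomial
ring `K[x_v : v ∈ V]` generated by the monomials `x_u x_v` with `{u, v}` an edge of `G`. -/
noncomputable def edgeIdeal {V : Type*} (K : Type*) [Field K] (G : SimpleGraph V) : Ideal (MvPolynomial V K) :=
  Ideal.span {p | ∃ u v : V, G.Adj u v ∧ p = MvPolynomial.X u * MvPolynomial.X v}

/-! A monomial lies in `I^k` iff its multiset of variables contains `k` disjoint edges, so the claim
is about matchings. Given a socle monomial `c` for `k = n + 1`, multiply it by an edge `ya` inside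
`c` whose ends are each missed by some `n`-matching of `c`. `exchange` (alternating paths) shows
that this raises the matching number by only one, so `yac` is a socle monomial for `k + 1`. -/

/-- `HasMatching G n c`: the multiset `c` of vertices contains `n` disjoint pairs of adjacent
vertices. -/
def HasMatching {V : Type*} (G : SimpleGraph V) : ℕ → Multiset V → Prop
  | 0, _ => True
  | n + 1, c => ∃ u v d, G.Adj u v ∧ c = u ::ₘ v ::ₘ d ∧ HasMatching G n d

namespace HasMatching

variable {V : Type*} {G : SimpleGraph V}

theorem cons {n : ℕ} {c : Multiset V} (h : HasMatching G n c) (x : V) :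
    HasMatching G n (x ::ₘ c) := by
  induction n generalizing c with
  | zero => trivial
  | succ n ih =>
    obtain ⟨u, v, d, huv, rfl, hd⟩ := h
    refine ⟨u, v, x ::ₘ d, huv, ?_, ih hd⟩
    rw [Multiset.cons_swap x u, Multiset.cons_swap x v]

theorem mono {n : ℕ} {c d : Multiset V} (h : HasMatching G n c) (hcd : c ≤ d) :
    HasMatching G n d := by
  obtain ⟨e, rfl⟩ := Multiset.le_iff_exists_add.1 hcd
  induction e using Multiset.induction with
  | empty => simpa using h
  | cons a s ih =>
    rw [Multiset.add_cons]
    exact (ih (Multiset.le_add_right _ _)).cons a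

theorem add_edge {n : ℕ} {c : Multiset V} (h : HasMatching G n c) {u v : V} (huv : G.Adj u v) :
    HasMatching G (n + 1) (u ::ₘ v ::ₘ c) :=
  ⟨u, v, c, huv, rfl, h⟩

theorem of_succ {n : ℕ} {c : Multiset V} (h : HasMatching G (n + 1) c) : HasMatching G n c := by
  obtain ⟨u, v, d, -, rfl, hd⟩ := h
  exact (hd.cons v).cons u

/-- Either the vertex `s` can be left uncovered, or it is matched to some `t`. -/
theorem of_cons {n : ℕ} {s : V} {c : Multiset V} (h : HasMatching G n (s ::ₘ c)) :
    HasMatching G n c ∨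
      ∃ t d m, c = t ::ₘ d ∧ n = m + 1 ∧ G.Adj s t ∧ HasMatching G m d := by
  induction n generalizing c with
  | zero => exact Or.inl trivial
  | succ n ih =>
    obtain ⟨u, v, d, huv, hc, hd⟩ := h
    rcases Multiset.cons_eq_cons.1 hc with ⟨rfl, rfl⟩ | ⟨-, c', rfl, hc'⟩
    · exact Or.inr ⟨v, d, n, rfl, rfl, huv, hd⟩
    rcases Multiset.cons_eq_cons.1 hc' with ⟨rfl, rfl⟩ | ⟨-, c'', rfl, rfl⟩
    · exact Or.inr ⟨u, d, n, rfl, rfl, huv.symm, hd⟩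
    rcases ih hd with h | ⟨t, d, m, rfl, rfl, hst, hd⟩
    · exact Or.inl (h.add_edge huv)
    · refine Or.inr ⟨t, u ::ₘ v ::ₘ d, m + 1, ?_, rfl, hst, hd.add_edge huv⟩
      rw [Multiset.cons_swap t u, Multiset.cons_swap t v]

/-- Exchange property of maximum matchings: if one of them misses `p` and `q` and another one
misses `r`, then some maximum matching misses `r` together with `p` or `q`. -/
theorem exchange {n : ℕ} {p q r : V} {e : Multiset V} (hr : HasMatching G n (r ::ₘ e))
    (hpq : HasMatching G n (p ::ₘ q ::ₘ e))
    (hmax : ¬ HasMatching G (n + 1) (p ::ₘ q ::ₘ r ::ₘ e)) :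
    HasMatching G n (q ::ₘ e) ∨ HasMatching G n (p ::ₘ e) := by
  induction n generalizing r e with
  | zero => exact Or.inl trivial
  | succ m ih =>
    rcases hr.of_cons with h | ⟨s, f, m, rfl, ⟨⟩, hrs, hf⟩
    · exact Or.inl (h.cons q)
    have hmax' : ¬ HasMatching G (m + 1) (p ::ₘ q ::ₘ f) := fun h => hmax <| by
      have := h.add_edge hrs
      rwa [Multiset.cons_swap s, Multiset.cons_swap r, Multiset.cons_swap s,
        Multiset.cons_swap r] at this
    rw [Multiset.cons_swap q, Multiset.cons_swap p] at hpq
    -- Alternating path `r, s, t, …`: if it reaches `p` or `q` it ends; otherwise `t` takes the role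
    -- of `r`.
    rcases hpq.of_cons with h | ⟨t, d, m, htd, ⟨⟩, hst, hd⟩
    · exact absurd h hmax'
    rcases Multiset.cons_eq_cons.1 htd with ⟨rfl, rfl⟩ | ⟨-, c', hc', rfl⟩
    · exact Or.inr (hf.add_edge hst.symm)
    rcases Multiset.cons_eq_cons.1 hc' with ⟨rfl, rfl⟩ | ⟨-, f', rfl, rfl⟩
    · exact Or.inl (hf.add_edge hst.symm)
    refine (ih hf hd hmax').imp (fun h => ?_) fun h => ?_
    · have := h.add_edge hst
      rwa [Multiset.cons_swap t, Multiset.cons_swap s] at this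
    · have := h.add_edge hst
      rwa [Multiset.cons_swap t, Multiset.cons_swap s] at this

/-- Duplicating an edge whose two ends are each missed by some maximum matching increases the
matching number by at most one. -/
theorem not_cons_cons {n : ℕ} {a y : V} {c : Multiset V} (hya : G.Adj y a)
    (ha : HasMatching G n (a ::ₘ c)) (hy : HasMatching G n (y ::ₘ c))
    (hmax : ¬ HasMatching G (n + 1) (y ::ₘ a ::ₘ c)) :
    ¬ HasMatching G (n + 2) (y ::ₘ a ::ₘ y ::ₘ a ::ₘ c) := by
  intro h
  generalize hC : y ::ₘ a ::ₘ c = C at h hmax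
  -- no maximum matching misses two adjacent vertices
  have key : ∀ {u v : V} {d : Multiset V}, G.Adj u v → C = u ::ₘ v ::ₘ d → ¬ HasMatching G n d :=
    fun huv hd h => hmax (hd ▸ h.add_edge huv)
  rcases h.of_cons with h | ⟨g, d, m, hg, ⟨⟩, hyg, hd⟩
  · rcases h.of_cons with h | ⟨b, d, m, rfl, ⟨⟩, -, hd⟩
    · exact hmax h.of_succ
    · exact hmax (hd.cons b)
  rcases Multiset.cons_eq_cons.1 hg with ⟨rfl, rfl⟩ | ⟨-, c', rfl, rfl⟩
  · exact hmax hd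
  rcases hd.of_cons with h | ⟨b, f, m, rfl, ⟨⟩, hab, hf⟩
  · exact hmax (h.cons g)
  -- The extra `y` and `a` are now matched to `g` and `b`, and `f` carries an `n`-matching of `C`
  -- missing `g` and `b`.
  have hyf : y ∈ f := by
    have : y ∈ g ::ₘ b ::ₘ f := hC ▸ Multiset.mem_cons_self _ _
    rcases Multiset.mem_cons.1 this with rfl | this
    · exact absurd hyg (G.loopless.irrefl _)
    rcases Multiset.mem_cons.1 this with rfl | this
    · exact absurd hf (key hyg.symm rfl)
    · exact this
  obtain ⟨e, rfl⟩ := Multiset.exists_cons_of_mem hyf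
  have hac : a ::ₘ c = g ::ₘ b ::ₘ e := by
    rw [← Multiset.cons_inj_right y, hC, Multiset.cons_swap y, Multiset.cons_swap y]
  -- Exchange at `y`: missing `y` and `g` is excluded by `key`, so some maximum matching misses `y`
  -- and `b`.
  have hge : HasMatching G n (g ::ₘ e) := by
    rcases exchange hf (hac ▸ ha) hmax with h | h
    · refine absurd h (key hyg ?_)
      rw [Multiset.cons_swap y, Multiset.cons_swap y]
    · exact h
  have hage : a ∈ g ::ₘ e := by
    have : a ∈ g ::ₘ b ::ₘ e := hac ▸ Multiset.mem_cons_self _ _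
    rw [Multiset.cons_swap] at this
    exact (Multiset.mem_cons.1 this).resolve_left hab.ne
  obtain ⟨e', he'⟩ := Multiset.exists_cons_of_mem hage
  have hc : c = b ::ₘ e' := by
    rw [← Multiset.cons_inj_right a, hac, Multiset.cons_swap, he', Multiset.cons_swap]
  subst hc
  rw [he'] at hge
  -- Exchange at `a`: it would be missed together with `y` or `b`, both adjacent to it.
  rcases exchange hge hy (by rwa [Multiset.cons_swap b, hC]) with h | h
  · exact key hya hC.symm h
  · refine key hab ?_ h
    rw [← hC, Multiset.cons_swap b, Multiset.cons_swap y, Multiset.cons_swap y]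

end HasMatching

section

open MvPolynomial

variable {V K : Type*} [Field K] (G : SimpleGraph V)

theorem mem_idealOfVars_iff_constantCoeff {σ R : Type*} [CommSemiring R] {f : MvPolynomial σ R} :
    f ∈ idealOfVars σ R ↔ constantCoeff f = 0 := by
  rw [← pow_one (idealOfVars σ R), mem_pow_idealOfVars_iff', constantCoeff_eq]
  refine ⟨fun h => h 0 (by simp), fun h s hs => ?_⟩
  rwa [(Finsupp.degree_eq_zero_iff s).1 (Nat.lt_one_iff.1 hs)]

theorem isPrime_idealOfVars {σ R : Type*} [CommRing R] [IsDomain R] :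
    (idealOfVars σ R).IsPrime := by
  have : idealOfVars σ R = RingHom.ker constantCoeff :=
    Ideal.ext fun _ => mem_idealOfVars_iff_constantCoeff
  exact this ▸ RingHom.ker_isPrime _

theorem edgeIdeal_pow_eq_span (k : ℕ) :
    edgeIdeal K G ^ k =
      Ideal.span ((fun s => monomial s (1 : K)) '' {s | HasMatching G k s.toMultiset}) := by
  classical
  induction k with
  | zero =>
    rw [pow_zero, Ideal.one_eq_top, eq_comm, Ideal.eq_top_iff_one]
    exact Ideal.subset_span ⟨0, trivial, rfl⟩
  | succ k ih =>
    rw [pow_succ', ih, edgeIdeal, Ideal.span_mul_span]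
    apply le_antisymm
    · rw [Ideal.span_le]
      rintro _ ⟨_, ⟨u, v, huv, rfl⟩, _, ⟨s, hs, rfl⟩, rfl⟩
      refine Ideal.subset_span ⟨.single u 1 + (.single v 1 + s), ⟨u, v, _, huv, ?_, hs⟩, ?_⟩
      · simpa using Multiset.cons_swap v u _
      · simp [X, monomial_mul, add_assoc]
    · rw [Ideal.span_le]
      rintro _ ⟨s, ⟨u, v, d, huv, hs, hd⟩, rfl⟩
      refine Ideal.subset_span ⟨_, ⟨u, v, huv, rfl⟩, _,
        ⟨Multiset.toFinsupp d, by simpa using hd, rfl⟩, ?_⟩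
      have : s = .single u 1 + (.single v 1 + Multiset.toFinsupp d) := by
        rw [Finsupp.toMultiset_eq_iff.1 hs]
        simp [← Multiset.singleton_add]
      simp [this, X, monomial_mul, add_assoc]

theorem mem_edgeIdeal_pow {k : ℕ} {f : MvPolynomial V K} :
    f ∈ edgeIdeal K G ^ k ↔ ∀ s ∈ f.support, HasMatching G k s.toMultiset := by
  rw [edgeIdeal_pow_eq_span, mem_ideal_span_monomial_image]
  refine forall₂_congr fun s _ => ⟨?_, fun h => ⟨s, h, le_rfl⟩⟩
  rintro ⟨t, ht, hts⟩
  obtain ⟨r, rfl⟩ := le_iff_exists_add.1 hts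
  rw [map_add]
  exact HasMatching.mono ht (Multiset.le_add_right _ _)

/-- The maximal homogeneous ideal is associated to `I(G)^k` iff some monomial outside `I(G)^k` is
multiplied into it by every variable. -/
theorem idealOfVars_mem_associatedPrimes_iff [Finite V] {k : ℕ} :
    idealOfVars V K ∈ associatedPrimes (MvPolynomial V K) (MvPolynomial V K ⧸ edgeIdeal K G ^ k) ↔
      ∃ c : Multiset V, ¬ HasMatching G k c ∧ ∀ x, HasMatching G k (x ::ₘ c) := by
  classical
  rw [AssociatedPrimes.mem_iff, isAssociatedPrime_iff]
  constructor
  · rintro ⟨hp, g, hg⟩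
    obtain ⟨f, rfl⟩ := Ideal.Quotient.mk_surjective g
    have key : ∀ r, r ∈ idealOfVars V K ↔ r * f ∈ edgeIdeal K G ^ k := fun r => by
      rw [hg, Submodule.mem_colon_singleton, Submodule.mem_bot, ← Ideal.Quotient.eq_zero_iff_mem]
      rfl
    have hf : f ∉ edgeIdeal K G ^ k := fun h =>
      hp.ne_top ((Ideal.eq_top_iff_one _).2 ((key 1).2 (by rwa [one_mul])))
    rw [mem_edgeIdeal_pow] at hf
    push Not at hf
    -- Multiplication by a variable shifts the support, so any monomial of `f` outside `I^k` works.
    obtain ⟨s, hs, hsk⟩ := hf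
    refine ⟨s.toMultiset, hsk, fun x => ?_⟩
    have := (mem_edgeIdeal_pow G).1 ((key (X x)).1 (Ideal.subset_span ⟨x, rfl⟩))
      (.single x 1 + s) (by rw [mem_support_iff, coeff_X_mul]; exact mem_support_iff.1 hs)
    simpa using this
  · rintro ⟨c, hc, hx⟩
    have key : idealOfVars V K = (⊥ : Submodule (MvPolynomial V K)
        (MvPolynomial V K ⧸ edgeIdeal K G ^ k)).colon
          {Ideal.Quotient.mk _ (monomial (Multiset.toFinsupp c) (1 : K))} := by
      ext r
      have : r ∈ (⊥ : Submodule (MvPolynomial V K)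
        (MvPolynomial V K ⧸ edgeIdeal K G ^ k)).colon
          {Ideal.Quotient.mk _ (monomial (Multiset.toFinsupp c) (1 : K))} ↔
          r * monomial (Multiset.toFinsupp c) 1 ∈ edgeIdeal K G ^ k := by
        rw [Submodule.mem_colon_singleton, Submodule.mem_bot, ← Ideal.Quotient.eq_zero_iff_mem]
        rfl
      rw [this]
      constructor
      · intro hr
        suffices idealOfVars V K ≤ (edgeIdeal K G ^ k).colon
            {monomial (Multiset.toFinsupp c) (1 : K)} from
          Submodule.mem_colon_singleton.1 (this hr)
        rw [Ideal.span_le]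
        rintro _ ⟨x, rfl⟩
        rw [SetLike.mem_coe, Submodule.mem_colon_singleton, smul_eq_mul, X, monomial_mul,
          mem_edgeIdeal_pow]
        intro s hs
        rw [Finset.mem_singleton.1 (support_monomial_subset hs)]
        simpa using hx x
      · intro h
        rw [mem_idealOfVars_iff_constantCoeff, constantCoeff_eq]
        by_contra h0
        refine hc ?_
        have := (mem_edgeIdeal_pow G).1 h (0 + Multiset.toFinsupp c)
          (by rw [mem_support_iff, coeff_mul_monomial]; simpa using h0)
        simpa using this
    exact ⟨isPrime_idealOfVars, _, key⟩

end

/-- If every vertex added to `c` increases its matching number, then some edge can be added to `c`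
increasing its matching number by exactly one. -/
theorem HasMatching.exists_persistent {V : Type*} [Nonempty V] {G : SimpleGraph V} {n : ℕ}
    {c : Multiset V} (hmax : ¬ HasMatching G (n + 1) c)
    (hx : ∀ x, HasMatching G (n + 1) (x ::ₘ c)) :
    ∃ u v, G.Adj u v ∧ ¬ HasMatching G (n + 2) (u ::ₘ v ::ₘ c) := by
  have key : ∀ x, ∃ t d, c = t ::ₘ d ∧ G.Adj x t ∧ HasMatching G n d := fun x => by
    rcases (hx x).of_cons with h | ⟨t, d, m, h, ⟨⟩, hxt, hd⟩
    · exact absurd h hmax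
    · exact ⟨t, d, h, hxt, hd⟩
  obtain ⟨y, d, rfl, -, hd⟩ := key (Classical.arbitrary V)
  obtain ⟨a, e, hae, hya, he⟩ := key y
  rcases Multiset.cons_eq_cons.1 hae with ⟨rfl, -⟩ | ⟨-, c, rfl, rfl⟩
  · exact absurd hya (G.loopless.irrefl _)
  · exact ⟨y, a, hya, not_cons_cons hya hd he hmax⟩

theorem proposition2p8 {V : Type*} [Finite V] (G : SimpleGraph V) (K : Type*) [Field K]
    (k : ℕ) (hk : 1 ≤ k)
    (h : MvPolynomial.idealOfVars V K ∈
      associatedPrimes (MvPolynomial V K) (MvPolynomial V K ⧸ edgeIdeal K G ^ k)) :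
    MvPolynomial.idealOfVars V K ∈
      associatedPrimes (MvPolynomial V K) (MvPolynomial V K ⧸ edgeIdeal K G ^ (k + 1)) := by
  rw [idealOfVars_mem_associatedPrimes_iff] at h ⊢
  obtain ⟨c, hc, hx⟩ := h
  obtain ⟨n, rfl⟩ := Nat.exists_eq_add_of_le' hk
  rcases isEmpty_or_nonempty V with hV | hV
  -- Without variables the condition on `x` is vacuous.
  · exact ⟨c, fun h => hc h.of_succ, fun x => isEmptyElim x⟩
  obtain ⟨u, v, huv, hmax⟩ := HasMatching.exists_persistent hc hx
  refine ⟨u ::ₘ v ::ₘ c, hmax, fun x => ?_⟩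
  rw [Multiset.cons_swap x u, Multiset.cons_swap x v]
  exact (hx x).add_edge huv
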